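/- Let $m=(m_k)_{k\ge 0}$ be a bounded sequence of integers $m_k\ge 2$, let $G_m=\prod_{k\ge 0}\mathbb{Z}/m_k\mathbb{Z}$ be the corresponding (bounded) Vilenkin group, and let $\mu$ be its normalized Haar measure, that is, the product of the uniform probability measures on the factors. Put $M_0=1$, $M_{k+1}=m_kM_k$, write each integer $n\ge 0$ as $n=\sum_k n_kM_k$ with $0\le n_k<m_k$, and let $\psi_n(x)=\prod_k \exp(2\pi i\,x_k/m_k)^{n_k}$ $(x\in G_m)$ be the Vilenkin system. For $f\in L^1(G_m)$ let $\widehat f(k)=\int_{G_m} f\,\overline{\psi_k}\,d\mu$ and $S_nf=\sum_{k=0}^{n-1}\widehat f(k)\psi_k$ (so $S_0f=0$). Let $(q_k)_{k\ge 0}$ be a sequence of non-negative real numbers with $q_0>0$, put $Q_n=\sum_{k=0}^{n-1}q_k$, assume $\lim_{n\to\infty}Q_n=\infty$, and define the $T$ means $$T_nf=\frac1{Q_n}\sum_{k=0}^{n-1}q_kS_kf\qquad(n\ge 1).$$ Suppose that either $(q_k)$ is non-increasing, or $(q_k)$ is non-decreasing and $q_{n-1}/Q_n=O(1/n)$ as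 $n\to\infty$. Then, for every $1\le p<\infty$ and every $f\in L^p(G_m)$, $$\lim_{n\to\infty}\|T_nf-f\|_p=0 .$$ -/

import Mathlib

open MeasureTheory Filter Topology Asymptotics
open scoped ENNReal

/-- The Vilenkin group `G_m`: the complete direct product of the cyclic groups `ℤ / m_k ℤ`
(with the product topology, product σ-algebra and coordinatewise addition). -/
abbrev VilenkinGroup (m : ℕ → ℕ) : Type := (k : ℕ) → ZMod (m k)

namespace Vilenkin

/-- The measure `μ_k` on `ℤ / m_k ℤ` giving mass `1 / m_k` to every point. -/
noncomputable def coordMeasure (m : ℕ → ℕ) (k : ℕ) : Measure (ZMod (m k)) :=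
  ((m k : ℝ≥0∞)⁻¹) • Measure.count

/-- The normalized Haar measure `μ` of `G_m`: the direct product of the measures `μ_k`. -/
noncomputable def haar (m : ℕ → ℕ) : Measure (VilenkinGroup m) :=
  Measure.infinitePi (coordMeasure m)

theorem coordMeasure_singleton (m : ℕ → ℕ) (k : ℕ) (j : ZMod (m k)) :
    coordMeasure m k {j} = (m k : ℝ≥0∞)⁻¹ := by
  simp [coordMeasure]

theorem isProbabilityMeasure_coordMeasure {m : ℕ → ℕ} (hm : ∀ k, 2 ≤ m k) (k : ℕ) :
    IsProbabilityMeasure (coordMeasure m k) := by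
  have h0 : m k ≠ 0 := by have := hm k; omega
  haveI : NeZero (m k) := ⟨h0⟩
  constructor
  have hc : (Measure.count : Measure (ZMod (m k))) Set.univ = (m k : ℝ≥0∞) := by
    rw [Measure.count_univ, ENat.card_eq_coe_fintype_card, ZMod.card]
    simp
  rw [coordMeasure, Measure.smul_apply, hc, smul_eq_mul]
  exact ENNReal.inv_mul_cancel (by exact_mod_cast h0) (by simp)

theorem isProbabilityMeasure_haar {m : ℕ → ℕ} (hm : ∀ k, 2 ≤ m k) :
    IsProbabilityMeasure (haar m) := by
  haveI := isProbabilityMeasure_coordMeasure hm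
  unfold haar
  infer_instance

/-- The generalized powers `M_0 = 1`, `M_{k+1} = m_k M_k`. -/
def M (m : ℕ → ℕ) : ℕ → ℕ
  | 0 => 1
  | k + 1 => m k * M m k

/-- The digit `n_k ∈ {0, …, m_k - 1}` in the expansion `n = ∑ n_k M_k`. -/
def digit (m : ℕ → ℕ) (n k : ℕ) : ℕ := n / M m k % m k

theorem two_pow_le_M {m : ℕ → ℕ} (hm : ∀ k, 2 ≤ m k) (k : ℕ) : 2 ^ k ≤ M m k := by
  induction k with
  | zero => simp [M]
  | succ k ih =>
    rw [M, pow_succ, mul_comm]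
    exact Nat.mul_le_mul (hm k) ih

/-- The digits of `n` vanish from position `n` on. -/
theorem digit_eq_zero {m : ℕ → ℕ} (hm : ∀ k, 2 ≤ m k) {n k : ℕ} (h : n ≤ k) :
    digit m n k = 0 := by
  have h1 : n < M m k :=
    lt_of_le_of_lt h (lt_of_lt_of_le Nat.lt_two_pow_self (two_pow_le_M hm k))
  simp [digit, Nat.div_eq_of_lt h1]

/-- The digits have the defining properties of the expansion of `n`. -/
theorem sum_digit {m : ℕ → ℕ} (hm : ∀ k, 2 ≤ m k) (n : ℕ) :
    (∀ k, digit m n k < m k) ∧ ∑ k ∈ Finset.range n, digit m n k * M m k = n := by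
  refine ⟨fun k => Nat.mod_lt _ (by have := hm k; omega), ?_⟩
  have key : ∀ N, ∑ k ∈ Finset.range N, digit m n k * M m k = n % M m N := by
    intro N
    induction N with
    | zero => simp [M, Nat.mod_one]
    | succ N ih =>
      rw [Finset.sum_range_succ, ih, M, mul_comm (m N), Nat.mod_mul, digit]
      ring
  rw [key n]
  exact Nat.mod_eq_of_lt (lt_of_lt_of_le Nat.lt_two_pow_self (two_pow_le_M hm n))

/-- The generalized Rademacher function `r_k(x) = exp(2πi x_k / m_k)`, where `x_k` is represented
in `{0, …, m_k - 1}`. -/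
noncomputable def rademacher (m : ℕ → ℕ) (k : ℕ) (x : VilenkinGroup m) : ℂ :=
  Complex.exp (2 * Real.pi * Complex.I * ((x k).val : ℂ) / (m k : ℂ))

/-- The Vilenkin function `ψ_n = ∏_k r_k ^ {n_k}`; the factors with `k ≥ n` equal `1`, because
the digits `n_k` vanish there. -/
noncomputable def psi (m : ℕ → ℕ) (n : ℕ) (x : VilenkinGroup m) : ℂ :=
  ∏ k ∈ Finset.range n, rademacher m k x ^ digit m n k

/-- The Vilenkin-Fourier coefficient of `f`. -/
noncomputable def fourierCoeff (m : ℕ → ℕ) (f : VilenkinGroup m → ℂ) (k : ℕ) : ℂ :=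
  ∫ x, f x * (starRingEnd ℂ) (psi m k x) ∂(haar m)

/-- The partial sum `S_n f` of the Vilenkin-Fourier series; `S_0 f = 0`. -/
noncomputable def partialSum (m : ℕ → ℕ) (f : VilenkinGroup m → ℂ) (n : ℕ)
    (x : VilenkinGroup m) : ℂ :=
  ∑ k ∈ Finset.range n, fourierCoeff m f k * psi m k x

/-- `Q_n = q_0 + … + q_{n-1}`. -/
def Q (q : ℕ → ℝ) (n : ℕ) : ℝ := ∑ k ∈ Finset.range n, q k

/-- The `n`-th `T` mean `T_n f = (1 / Q_n) ∑_{k=0}^{n-1} q_k S_k f` (for `n ≥ 1`). -/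
noncomputable def tMean (m : ℕ → ℕ) (q : ℕ → ℝ) (f : VilenkinGroup m → ℂ) (n : ℕ)
    (x : VilenkinGroup m) : ℂ :=
  ((1 / Q q n : ℝ) : ℂ) * ∑ k ∈ Finset.range n, (q k : ℂ) * partialSum m f k x

end Vilenkin

/-!
The Fejér-type sums `D_0 + ⋯ + D_{n-1}` of Dirichlet kernels satisfy a recursion over the digits of
`n`, whose terms are products of Dirichlet kernels of the factors `ℤ / m_k ℤ`, of `L¹` norm `1`,
with coefficients controlled by `m`. Since `m` is bounded, the sums have `L¹` norm `O(n)`, so by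
Schur's test `‖S_0 f + ⋯ + S_{n-1} f‖_p ≤ C n ‖f‖_p`. Abel summation rewrites `Q_n T_n f` in
terms of these sums with coefficients of total weight `O(Q_n)`, whence the operators `T_n` are
eventually uniformly bounded on `L^p`. It remains to prove convergence on a dense set. A function
`g` of finitely many coordinates satisfies `S_k g = g` from some `k` on, so `Q_n (T_n g - g)` is
eventually constant in `n`, and `Q_n → ∞`.
-/

section Enorm

theorem enorm_natCast {𝕜 : Type*} [RCLike 𝕜] (n : ℕ) : ‖(n : 𝕜)‖ₑ = n := by
  rw [← ofReal_norm, RCLike.norm_natCast, ENNReal.ofReal_natCast]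

theorem enorm_finset_prod {ι 𝕜 : Type*} [NormedField 𝕜] (s : Finset ι) (f : ι → 𝕜) :
    ‖∏ i ∈ s, f i‖ₑ = ∏ i ∈ s, ‖f i‖ₑ := by
  simp only [← ofReal_norm, norm_prod, ENNReal.ofReal_prod_of_nonneg fun _ _ => norm_nonneg _]

end Enorm

section InvariantMeasures

variable {ι : Type*} {G : ι → Type*} [∀ i, AddGroup (G i)] [∀ i, MeasurableSpace (G i)]
  (μ : ∀ i, Measure (G i)) [∀ i, IsProbabilityMeasure (μ i)]

theorem isAddLeftInvariant_infinitePi [∀ i, MeasurableAdd (G i)]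
    [∀ i, (μ i).IsAddLeftInvariant] : (Measure.infinitePi μ).IsAddLeftInvariant where
  map_add_left_eq_self g := by
    refine (Measure.infinitePi_map_pi μ fun i => measurable_const_add (g i)).trans ?_
    simp only [map_add_left_eq_self]

theorem isNegInvariant_infinitePi [∀ i, MeasurableNeg (G i)]
    [∀ i, (μ i).IsNegInvariant] : (Measure.infinitePi μ).IsNegInvariant where
  neg_eq_self := by
    refine (Measure.infinitePi_map_pi μ fun i => measurable_neg).trans ?_
    simp only [Measure.map_neg_eq_self]

end InvariantMeasures

section SchurTest

variable {α β : Type*} [MeasurableSpace α] [MeasurableSpace β] {μ : Measure α} {ν : Measure β}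

theorem lintegral_mul_rpow_le_lintegral_rpow_mul {r : ℝ} (hr : 1 ≤ r) {f k : β → ℝ≥0∞}
    (hf : AEMeasurable f ν) (hk : AEMeasurable k ν) :
    (∫⁻ t, f t * k t ∂ν) ^ r ≤ (∫⁻ t, f t ^ r * k t ∂ν) * (∫⁻ t, k t ∂ν) ^ (r - 1) := by
  have hr0 : 0 < r := zero_lt_one.trans_le hr
  have hr' : 0 ≤ 1 - 1 / r := sub_nonneg.2 ((div_le_one hr0).2 hr)
  have split (t : β) : f t * k t = (f t ^ r * k t) ^ (1 / r) * k t ^ (1 - 1 / r) := by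
    rw [ENNReal.mul_rpow_of_nonneg _ _ (by positivity), ← ENNReal.rpow_mul,
      mul_one_div_cancel hr0.ne', ENNReal.rpow_one, mul_assoc,
      ← ENNReal.rpow_add_of_nonneg _ _ (by positivity) hr', add_sub_cancel, ENNReal.rpow_one]
  calc (∫⁻ t, f t * k t ∂ν) ^ r
      ≤ ((∫⁻ t, f t ^ r * k t ∂ν) ^ (1 / r) * (∫⁻ t, k t ∂ν) ^ (1 - 1 / r)) ^ r := by
        simp only [split]
        gcongr
        exact ENNReal.lintegral_mul_norm_pow_le ((hf.pow_const r).mul hk) hk (by positivity) hr'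
          (by ring)
    _ = (∫⁻ t, f t ^ r * k t ∂ν) * (∫⁻ t, k t ∂ν) ^ (r - 1) := by
        rw [ENNReal.mul_rpow_of_nonneg _ _ hr0.le, ← ENNReal.rpow_mul, ← ENNReal.rpow_mul,
          one_div_mul_cancel hr0.ne', ENNReal.rpow_one, sub_mul, one_mul,
          one_div_mul_cancel hr0.ne']

theorem lintegral_lintegral_mul_rpow_le [SFinite μ] [SFinite ν] {k : α → β → ℝ≥0∞}
    (hk : Measurable (Function.uncurry k)) {C₁ C₂ : ℝ≥0∞} (hC₁ : ∀ x, ∫⁻ t, k x t ∂ν ≤ C₁)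
    (hC₂ : ∀ t, ∫⁻ x, k x t ∂μ ≤ C₂) {r : ℝ} (hr : 1 ≤ r) {f : β → ℝ≥0∞} (hf : AEMeasurable f ν) :
    ∫⁻ x, (∫⁻ t, f t * k x t ∂ν) ^ r ∂μ ≤ C₁ ^ (r - 1) * C₂ * ∫⁻ t, f t ^ r ∂ν := by
  have hfr : AEMeasurable (fun t => f t ^ r) ν := hf.pow_const r
  have hprod : AEMeasurable (Function.uncurry fun x t => f t ^ r * k x t) (μ.prod ν) :=
    (hfr.comp_quasiMeasurePreserving Measure.quasiMeasurePreserving_snd).mul hk.aemeasurable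
  calc ∫⁻ x, (∫⁻ t, f t * k x t ∂ν) ^ r ∂μ
      ≤ ∫⁻ x, C₁ ^ (r - 1) * (∫⁻ t, f t ^ r * k x t ∂ν) ∂μ := by
        refine lintegral_mono fun x => ?_
        refine (lintegral_mul_rpow_le_lintegral_rpow_mul hr hf
          hk.of_uncurry_left.aemeasurable).trans ((mul_comm _ _).trans_le ?_)
        gcongr ?_ * _
        exact ENNReal.rpow_le_rpow (hC₁ x) (sub_nonneg.2 hr)
    _ = C₁ ^ (r - 1) * ∫⁻ t, ∫⁻ x, f t ^ r * k x t ∂μ ∂ν := by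
        rw [← lintegral_lintegral_swap hprod]
        exact lintegral_const_mul'' _ hprod.lintegral_prod_right'
    _ = C₁ ^ (r - 1) * ∫⁻ t, f t ^ r * ∫⁻ x, k x t ∂μ ∂ν := by
        simp only [lintegral_const_mul _ hk.of_uncurry_right]
    _ ≤ C₁ ^ (r - 1) * ∫⁻ t, f t ^ r * C₂ ∂ν := by
        gcongr with t
        exact hC₂ t
    _ = C₁ ^ (r - 1) * C₂ * ∫⁻ t, f t ^ r ∂ν := by
        rw [lintegral_mul_const'' _ hfr, mul_assoc, mul_comm C₂]

theorem eLpNorm_integral_kernel_smul_le [SFinite μ] [SFinite ν] {𝕜 E : Type*} [NormedField 𝕜]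
    [MeasurableSpace 𝕜] [OpensMeasurableSpace 𝕜] [NormedAddCommGroup E] [NormedSpace ℝ E]
    [NormedSpace 𝕜 E] {K : α → β → 𝕜} (hK : Measurable (Function.uncurry K)) {C : ℝ≥0∞}
    (hC₁ : ∀ x, ∫⁻ t, ‖K x t‖ₑ ∂ν ≤ C) (hC₂ : ∀ t, ∫⁻ x, ‖K x t‖ₑ ∂μ ≤ C)
    {p : ℝ≥0∞} (hp1 : 1 ≤ p) (hp : p ≠ ∞) {f : β → E} (hf : AEStronglyMeasurable f ν) :
    eLpNorm (fun x => ∫ t, K x t • f t ∂ν) p μ ≤ C * eLpNorm f p ν := by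
  have hr : 1 ≤ p.toReal := by simpa using ENNReal.toReal_mono hp hp1
  have hr0 : 0 < p.toReal := zero_lt_one.trans_le hr
  have hp0 : p ≠ 0 := (zero_lt_one.trans_le hp1).ne'
  rw [eLpNorm_eq_lintegral_rpow_enorm_toReal hp0 hp, eLpNorm_eq_lintegral_rpow_enorm_toReal hp0 hp]
  calc (∫⁻ x, ‖∫ t, K x t • f t ∂ν‖ₑ ^ p.toReal ∂μ) ^ (1 / p.toReal)
      ≤ (∫⁻ x, (∫⁻ t, ‖f t‖ₑ * ‖K x t‖ₑ ∂ν) ^ p.toReal ∂μ) ^ (1 / p.toReal) := by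
        gcongr with x
        refine (enorm_integral_le_lintegral_enorm _).trans_eq (lintegral_congr fun t => ?_)
        rw [enorm_smul, mul_comm]
    _ ≤ (C ^ (p.toReal - 1) * C * ∫⁻ t, ‖f t‖ₑ ^ p.toReal ∂ν) ^ (1 / p.toReal) := by
        gcongr
        exact lintegral_lintegral_mul_rpow_le hK.enorm hC₁ hC₂ hr hf.enorm
    _ = C * (∫⁻ t, ‖f t‖ₑ ^ p.toReal ∂ν) ^ (1 / p.toReal) := by
        have hpow : C ^ (p.toReal - 1) * C = C ^ p.toReal := by
          simpa using (ENNReal.rpow_add_of_nonneg (x := C) _ 1 (sub_nonneg.2 hr) zero_le_one).symm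
        rw [hpow, ENNReal.mul_rpow_of_nonneg _ _ (by positivity), ← ENNReal.rpow_mul,
          mul_one_div_cancel hr0.ne', ENNReal.rpow_one]

end SchurTest

section LpApproximation

theorem exists_dependsOn_finset_eLpNorm_sub_le {ι : Type*} {X : ι → Type*}
    [∀ i, MeasurableSpace (X i)] {μ : Measure (∀ i, X i)} [IsFiniteMeasure μ] {E : Type*}
    [NormedAddCommGroup E] {p : ℝ≥0∞} (hp : p ≠ ∞) {f : (∀ i, X i) → E} (hf : MemLp f p μ)
    {ε : ℝ≥0∞} (hε : ε ≠ 0) :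
    ∃ g, eLpNorm (f - g) p μ ≤ ε ∧ MemLp g p μ ∧ ∃ s : Finset ι, DependsOn g s := by
  classical
  refine MemLp.induction_dense hp (fun g => MemLp g p μ ∧ ∃ s : Finset ι, DependsOn g s)
    ?_ ?_ (fun g hg => hg.1.1) hf hε
  · intro c A hA _ ε hε
    obtain ⟨δ, hδ, hsmall⟩ := exists_eLpNorm_indicator_le (μ := μ) hp c hε
    obtain ⟨B, hB, hAB⟩ := (Measure.MeasureDense.of_generateFrom_isSetAlgebra_finite μ
      isSetAlgebra_measurableCylinders generateFrom_measurableCylinders.symm).approx A hA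
      (measure_ne_top μ A) δ (by exact_mod_cast hδ)
    rw [ENNReal.ofReal_coe_nnreal, symmDiff_comm] at hAB
    obtain ⟨s, S, hS, rfl⟩ := (mem_measurableCylinders B).1 hB
    refine ⟨(cylinder s S).indicator fun _ => c, ?_,
      memLp_indicator_const p (hS.cylinder s) c (Or.inr (measure_ne_top μ _)),
      s, dependsOn_cylinder_indicator_const S c⟩
    rw [eLpNorm_indicator_sub_indicator]
    exact hsmall _ hAB.le
  · rintro g h ⟨hg, s, hgs⟩ ⟨hh, t, hht⟩
    refine ⟨hg.add hh, s ∪ t, fun x y hxy => ?_⟩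
    simp only [Pi.add_apply]
    rw [hgs fun i hi => hxy i (by simp_all), hht fun i hi => hxy i (by simp_all)]

variable {α E : Type*} [MeasurableSpace α] {μ : Measure α} [NormedAddCommGroup E]
  {p : ℝ≥0∞}

theorem tendsto_eLpNorm_sub_of_dense {ι : Type*} {l : Filter ι} {T : ι → (α → E) → α → E}
    {C : ℝ≥0∞} (hC : C ≠ ∞) (hp1 : 1 ≤ p)
    (hsub : ∀ i f g, MemLp f p μ → MemLp g p μ → T i (f - g) = T i f - T i g)
    (hmeas : ∀ i f, MemLp f p μ → AEStronglyMeasurable (T i f) μ)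
    (hbound : ∀ᶠ i in l, ∀ f, MemLp f p μ → eLpNorm (T i f) p μ ≤ C * eLpNorm f p μ)
    {f : α → E} (hf : MemLp f p μ)
    (hdense : ∀ ε : ℝ≥0∞, ε ≠ 0 → ∃ g, eLpNorm (f - g) p μ ≤ ε ∧ MemLp g p μ ∧
      Tendsto (fun i => eLpNorm (T i g - g) p μ) l (𝓝 0)) :
    Tendsto (fun i => eLpNorm (T i f - f) p μ) l (𝓝 0) := by
  refine ENNReal.tendsto_nhds_zero.2 fun ε hε => ?_
  have hC2 : C + 2 ≠ ∞ := by simp [hC]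
  have hδ : ε / (C + 2) ≠ 0 := (ENNReal.div_pos hε.ne' hC2).ne'
  obtain ⟨g, hfg, hg, hlim⟩ := hdense _ hδ
  filter_upwards [hbound, ENNReal.tendsto_nhds_zero.1 hlim _ hδ.bot_lt] with i hi hTg
  have split : T i f - f = T i (f - g) + (T i g - g) + (g - f) := by
    rw [hsub i f g hf hg]; abel
  have hTfg := hmeas i (f - g) (hf.sub hg)
  have hTgg := (hmeas i g hg).sub hg.1
  calc eLpNorm (T i f - f) p μ
      ≤ eLpNorm (T i (f - g)) p μ + eLpNorm (T i g - g) p μ + eLpNorm (f - g) p μ := by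
        rw [split, eLpNorm_sub_comm f g]
        refine (eLpNorm_add_le (hTfg.add hTgg) (hg.1.sub hf.1) hp1).trans ?_
        gcongr
        exact eLpNorm_add_le hTfg hTgg hp1
    _ ≤ C * (ε / (C + 2)) + ε / (C + 2) + ε / (C + 2) := by
        gcongr
        exact (hi _ (hf.sub hg)).trans (by gcongr)
    _ = (C + 2) * (ε / (C + 2)) := by ring
    _ ≤ ε := ENNReal.mul_div_le

end LpApproximation

section SummationByParts

/-- The sum `|q_{n-1}| n + ∑_{i < n-1} |q_{i+1} - q_i| (i + 1)` of the absolute values of the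
coefficients that Abel summation of `∑_{k < n} q_k u_k` attaches to the means
`(u_0 + ⋯ + u_i) / (i + 1)`. It vanishes for `n = 0`. -/
noncomputable def weightVariation (q : ℕ → ℝ) (n : ℕ) : ℝ :=
  |q (n - 1)| * n + ∑ i ∈ Finset.range (n - 1), |q (i + 1) - q i| * (i + 1 : ℕ)

theorem eLpNorm_sum_smul_le_weightVariation {α E : Type*} [MeasurableSpace α] {μ : Measure α}
    [NormedAddCommGroup E] [NormedSpace ℝ E] {p : ℝ≥0∞} (hp1 : 1 ≤ p) {u : ℕ → α → E}
    (hu : ∀ k, AEStronglyMeasurable (u k) μ) {A : ℝ≥0∞}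
    (hA : ∀ n, eLpNorm (∑ k ∈ Finset.range n, u k) p μ ≤ n * A) (q : ℕ → ℝ) (n : ℕ) :
    eLpNorm (∑ k ∈ Finset.range n, q k • u k) p μ ≤ ENNReal.ofReal (weightVariation q n) * A := by
  set U : ℕ → α → E := fun n => ∑ k ∈ Finset.range n, u k
  have hU (c : ℝ) (n : ℕ) : AEStronglyMeasurable (c • U n) μ :=
    (Finset.aestronglyMeasurable_sum _ fun k _ => hu k).const_smul c
  have hle (c : ℝ) (n : ℕ) : eLpNorm (c • U n) p μ ≤ ENNReal.ofReal (|c| * n) * A := by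
    rw [eLpNorm_const_smul, ENNReal.ofReal_mul (abs_nonneg c), ENNReal.ofReal_natCast,
      Real.enorm_eq_ofReal_abs, mul_assoc]
    gcongr
    exact hA n
  rw [Finset.sum_range_by_parts q u n]
  calc eLpNorm (q (n - 1) • U n - ∑ i ∈ Finset.range (n - 1), (q (i + 1) - q i) • U (i + 1)) p μ
      ≤ eLpNorm (q (n - 1) • U n) p μ
          + ∑ i ∈ Finset.range (n - 1), eLpNorm ((q (i + 1) - q i) • U (i + 1)) p μ := by
        refine (eLpNorm_sub_le (hU _ _) (Finset.aestronglyMeasurable_sum _ fun i _ => hU _ _)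
          hp1).trans ?_
        gcongr
        exact eLpNorm_sum_le (fun i _ => hU _ _) hp1
    _ ≤ ENNReal.ofReal (|q (n - 1)| * n) * A
          + ∑ i ∈ Finset.range (n - 1), ENNReal.ofReal (|q (i + 1) - q i| * (i + 1 : ℕ)) * A :=
        add_le_add (hle _ _) (Finset.sum_le_sum fun i _ => hle _ _)
    _ = ENNReal.ofReal (weightVariation q n) * A := by
        rw [weightVariation, ENNReal.ofReal_add (by positivity) (by positivity),
          ENNReal.ofReal_sum_of_nonneg fun _ _ => by positivity, add_mul, Finset.sum_mul]

end SummationByParts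

namespace Vilenkin

section Weights

variable {q : ℕ → ℝ}

theorem Q_eq_mul_sub_sum (q : ℕ → ℝ) (n : ℕ) :
    Q q n = q (n - 1) * n - ∑ i ∈ Finset.range (n - 1), (q (i + 1) - q i) * (i + 1 : ℕ) := by
  simpa [Q] using Finset.sum_range_by_parts q (fun _ => (1 : ℝ)) n

theorem weightVariation_of_antitone (hq : ∀ k, 0 ≤ q k) (h : Antitone q) (n : ℕ) :
    weightVariation q n = Q q n := by
  have habs (i : ℕ) : |q (i + 1) - q i| = -(q (i + 1) - q i) :=
    abs_of_nonpos (sub_nonpos.2 (h i.le_succ))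
  rw [Q_eq_mul_sub_sum]
  simp only [weightVariation, abs_of_nonneg (hq _), habs, neg_mul, Finset.sum_neg_distrib,
    ← sub_eq_add_neg]

theorem weightVariation_of_monotone (hq : ∀ k, 0 ≤ q k) (h : Monotone q) (n : ℕ) :
    weightVariation q n = 2 * (q (n - 1) * n) - Q q n := by
  have habs (i : ℕ) : |q (i + 1) - q i| = q (i + 1) - q i :=
    abs_of_nonneg (sub_nonneg.2 (h i.le_succ))
  rw [Q_eq_mul_sub_sum]
  simp only [weightVariation, abs_of_nonneg (hq _), habs]
  ring

theorem weightVariation_isBigO_Q (hq : ∀ k, 0 ≤ q k) (hQ : Tendsto (Q q) atTop atTop)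
    (hmono : Antitone q ∨
      (Monotone q ∧ (fun n : ℕ => q (n - 1) / Q q n) =O[atTop] (fun n : ℕ => 1 / (n : ℝ)))) :
    weightVariation q =O[atTop] Q q := by
  rcases hmono with h | ⟨h, hO⟩
  · simpa only [funext (weightVariation_of_antitone hq h)] using isBigO_refl (Q q) atTop
  · have hqn : (fun n : ℕ => q (n - 1) * n) =O[atTop] Q q := by
      refine (hO.mul (isBigO_refl (fun n : ℕ => Q q n * n) atTop)).congr' ?_ ?_
      · filter_upwards [hQ.eventually_ne_atTop 0] with n hn
        field_simp
      · filter_upwards [eventually_ne_atTop 0] with n hn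
        field_simp
    simpa only [funext (weightVariation_of_monotone hq h)] using
      (hqn.const_mul_left 2).sub (isBigO_refl (Q q) atTop)

end Weights

variable {m : ℕ → ℕ}

theorem neZero_of_two_le (hm : ∀ k, 2 ≤ m k) (k : ℕ) : NeZero (m k) :=
  ⟨(zero_lt_two.trans_le (hm k)).ne'⟩

section Digits

theorem M_pos [∀ k, NeZero (m k)] (k : ℕ) : 0 < M m k := by
  induction k with
  | zero => exact one_pos
  | succ k ih => exact Nat.mul_pos (NeZero.pos (m k)) ih

theorem M_dvd_M {i k : ℕ} (h : i ≤ k) : M m i ∣ M m k := by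
  induction k, h using Nat.le_induction with
  | base => rfl
  | succ k _ ih => exact ih.trans (Dvd.intro_left (m k) rfl)

theorem digit_eq_zero_of_lt_M {n k : ℕ} (h : n < M m k) : digit m n k = 0 := by
  simp [digit, Nat.div_eq_of_lt h]

theorem mul_M_add_lt_M_succ {k s j : ℕ} (hs : s < m k) (hj : j < M m k) :
    s * M m k + j < M m (k + 1) :=
  calc s * M m k + j < s * M m k + M m k := Nat.add_lt_add_left hj _
    _ = (s + 1) * M m k := (Nat.succ_mul _ _).symm
    _ ≤ m k * M m k := Nat.mul_le_mul_right _ hs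

theorem digit_mul_M_add [∀ k, NeZero (m k)] {k s j : ℕ} (hs : s < m k) (hj : j < M m k) (i : ℕ) :
    digit m (s * M m k + j) i = if i = k then s else digit m j i := by
  rcases lt_trichotomy i k with h | rfl | h
  · have digit_eq_mod (n : ℕ) : digit m n i = n % M m (i + 1) / M m i := by
      rw [digit, M, mul_comm, Nat.mod_mul_right_div_self]
    obtain ⟨c, hc⟩ : M m (i + 1) ∣ s * M m k := (M_dvd_M h).mul_left s
    rw [if_neg h.ne, digit_eq_mod, digit_eq_mod, hc, Nat.mul_add_mod]
  · rw [if_pos rfl, digit, add_comm, Nat.add_mul_div_right _ _ (M_pos i), Nat.div_eq_of_lt hj,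
      zero_add, Nat.mod_eq_of_lt hs]
  · have hlt : s * M m k + j < M m i :=
      (mul_M_add_lt_M_succ hs hj).trans_le (Nat.le_of_dvd (M_pos i) (M_dvd_M h))
    rw [if_neg h.ne', digit_eq_zero_of_lt_M hlt,
      digit_eq_zero_of_lt_M ((Nat.le_add_left _ _).trans_lt hlt)]

theorem exists_digit_ne_zero_of_M_le (hm : ∀ k, 2 ≤ m k) {N n : ℕ} (h : M m N ≤ n) :
    ∃ i, N ≤ i ∧ digit m n i ≠ 0 := by
  have := neZero_of_two_le hm
  by_contra! hzero
  have hmod (i : ℕ) (hi : N ≤ i) : n % M m i = n % M m N := by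
    induction i, hi using Nat.le_induction with
    | base => rfl
    | succ i hi ih =>
      have hdigit : n / M m i % m i = 0 := hzero i hi
      rw [M, mul_comm, Nat.mod_mul, hdigit, mul_zero, add_zero, ih]
  have hlt : n < M m (max N n) :=
    ((le_max_right N n).trans_lt Nat.lt_two_pow_self).trans_le (two_pow_le_M hm _)
  have hn : n = n % M m N := (Nat.mod_eq_of_lt hlt).symm.trans (hmod _ (le_max_left N n))
  exact (h.trans_eq hn).not_gt (Nat.mod_lt n (M_pos N))

theorem sum_M_le (hm : ∀ k, 2 ≤ m k) (K : ℕ) : ∑ k ∈ Finset.range K, M m k ≤ M m K := by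
  induction K with
  | zero => simp
  | succ K ih =>
    rw [Finset.sum_range_succ, M]
    have := Nat.mul_le_mul_right (M m K) (hm K)
    omega

end Digits

section Characters

theorem measurable_rademacher (m : ℕ → ℕ) (k : ℕ) : Measurable (rademacher m k) :=
  (measurable_from_top (f := fun a : ZMod (m k) =>
    Complex.exp (2 * Real.pi * Complex.I * (a.val : ℂ) / (m k : ℂ)))).comp (measurable_pi_apply k)

theorem measurable_psi (m : ℕ → ℕ) (n : ℕ) : Measurable (psi m n) :=
  Finset.measurable_fun_prod _ fun k _ => (measurable_rademacher m k).pow_const _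

theorem psi_zero (x : VilenkinGroup m) : psi m 0 x = 1 := by simp [psi]

section

variable [∀ k, NeZero (m k)]

theorem rademacher_eq_stdAddChar (k : ℕ) (x : VilenkinGroup m) :
    rademacher m k x = ZMod.stdAddChar (x k) := by
  rw [ZMod.stdAddChar_apply, ZMod.toCircle_apply, rademacher]

theorem norm_rademacher (k : ℕ) (x : VilenkinGroup m) : ‖rademacher m k x‖ = 1 := by
  rw [rademacher_eq_stdAddChar, ZMod.stdAddChar_apply, Circle.norm_coe]

theorem enorm_rademacher (k : ℕ) (x : VilenkinGroup m) : ‖rademacher m k x‖ₑ = 1 := by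
  rw [← ofReal_norm, norm_rademacher, ENNReal.ofReal_one]

theorem norm_psi (n : ℕ) (x : VilenkinGroup m) : ‖psi m n x‖ = 1 := by
  simp [psi, norm_rademacher]

theorem psi_add (n : ℕ) (x y : VilenkinGroup m) : psi m n (x + y) = psi m n x * psi m n y := by
  simp only [psi, rademacher_eq_stdAddChar, Pi.add_apply, AddChar.map_add_eq_mul, mul_pow,
    Finset.prod_mul_distrib]

theorem psi_sub (n : ℕ) (x t : VilenkinGroup m) :
    psi m n (x - t) = psi m n x * (starRingEnd ℂ) (psi m n t) := by
  have hinv : psi m n t * (starRingEnd ℂ) (psi m n t) = 1 := by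
    rw [Complex.mul_conj, Complex.normSq_eq_norm_sq, norm_psi]; norm_num
  calc psi m n (x - t) = psi m n (x - t) * (psi m n t * (starRingEnd ℂ) (psi m n t)) := by
        rw [hinv, mul_one]
    _ = psi m n x * (starRingEnd ℂ) (psi m n t) := by
        rw [← mul_assoc, ← psi_add, sub_add_cancel]

end

theorem psi_eq_prod_range (hm : ∀ k, 2 ≤ m k) {n N : ℕ} (h : n ≤ N) (x : VilenkinGroup m) :
    psi m n x = ∏ k ∈ Finset.range N, rademacher m k x ^ digit m n k := by
  refine Finset.prod_subset (Finset.range_mono h) fun k _ hk => ?_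
  rw [digit_eq_zero hm (by simpa using hk), pow_zero]

theorem psi_mul_M_add (hm : ∀ k, 2 ≤ m k) {k s j : ℕ} (hs : s < m k) (hj : j < M m k)
    (x : VilenkinGroup m) :
    psi m (s * M m k + j) x = rademacher m k x ^ s * psi m j x := by
  have := neZero_of_two_le hm
  obtain ⟨N, hN, hkN⟩ : ∃ N, s * M m k + j ≤ N ∧ k ∈ Finset.range N :=
    ⟨s * M m k + j + (k + 1), by omega, Finset.mem_range.2 (by omega)⟩
  have hdigit : digit m j k = 0 := digit_eq_zero_of_lt_M hj
  rw [psi_eq_prod_range hm hN, psi_eq_prod_range hm ((Nat.le_add_left _ _).trans hN),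
    ← Finset.mul_prod_erase _ _ hkN, ← Finset.mul_prod_erase _ _ hkN, hdigit, pow_zero, one_mul,
    digit_mul_M_add hs hj, if_pos rfl]
  congr 1
  refine Finset.prod_congr rfl fun i hi => ?_
  rw [digit_mul_M_add hs hj, if_neg (Finset.ne_of_mem_erase hi)]

theorem psi_single_ne_one (hm : ∀ k, 2 ≤ m k) {n i : ℕ} (hi : digit m n i ≠ 0) :
    psi m n (Pi.single i 1) ≠ 1 := by
  have := neZero_of_two_le hm
  have hin : i < n := by
    by_contra! h
    exact hi (digit_eq_zero hm h)
  have hpsi : psi m n (Pi.single i 1) = ZMod.stdAddChar (digit m n i : ZMod (m i)) := by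
    rw [psi, Finset.prod_eq_single_of_mem i (Finset.mem_range.2 hin), rademacher_eq_stdAddChar,
      Pi.single_eq_same, ← AddChar.map_nsmul_eq_pow, nsmul_one]
    intro k _ hk
    rw [rademacher_eq_stdAddChar, Pi.single_eq_of_ne hk, AddChar.map_zero_eq_one, one_pow]
  have hdigit : (digit m n i : ZMod (m i)) ≠ 0 := by
    rw [Ne, ZMod.natCast_eq_zero_iff]
    exact Nat.not_dvd_of_pos_of_lt (Nat.pos_of_ne_zero hi) ((sum_digit hm n).1 i)
  rw [hpsi, ← AddChar.map_zero_eq_one (ZMod.stdAddChar (N := m i))]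
  exact ZMod.injective_stdAddChar.ne hdigit

end Characters

/-- The Dirichlet kernel `D_n = ∑_{j < n} ψ_j`. -/
noncomputable def dirichletKernel (m : ℕ → ℕ) (n : ℕ) (x : VilenkinGroup m) : ℂ :=
  ∑ j ∈ Finset.range n, psi m j x

/-- The sum `D_0 + ⋯ + D_{n-1}`, that is, `n` times the Fejér kernel `K_n`; leaving it unnormalized
makes it satisfy a recursion over the digits of `n`. -/
noncomputable def fejerSum (m : ℕ → ℕ) (n : ℕ) (x : VilenkinGroup m) : ℂ :=
  ∑ j ∈ Finset.range n, dirichletKernel m j x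

/-- The Dirichlet kernel `∑_{l < m_k} r_k ^ l` of the factor `ℤ / m_k ℤ`; the kernels `D_{M_k}` are
products of these. -/
noncomputable def coordKernel (m : ℕ → ℕ) (k : ℕ) (x : VilenkinGroup m) : ℂ :=
  ∑ l ∈ Finset.range (m k), rademacher m k x ^ l

theorem measurable_dirichletKernel (m : ℕ → ℕ) (n : ℕ) : Measurable (dirichletKernel m n) :=
  Finset.measurable_fun_sum _ fun j _ => measurable_psi m j

theorem measurable_fejerSum (m : ℕ → ℕ) (n : ℕ) : Measurable (fejerSum m n) :=
  Finset.measurable_fun_sum _ fun j _ => measurable_dirichletKernel m j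

theorem measurable_coordKernel (m : ℕ → ℕ) (k : ℕ) : Measurable (coordKernel m k) :=
  Finset.measurable_fun_sum _ fun _ _ => (measurable_rademacher m k).pow_const _

section PointwiseBounds

variable [∀ k, NeZero (m k)]

theorem coordKernel_eq_ite (k : ℕ) (x : VilenkinGroup m) :
    coordKernel m k x = if x k = 0 then (m k : ℂ) else 0 := by
  rw [coordKernel, rademacher_eq_stdAddChar]
  split_ifs with h
  · simp [h]
  · have hne : ZMod.stdAddChar (x k) ≠ 1 := by
      rw [← AddChar.map_zero_eq_one (ZMod.stdAddChar (N := m k))]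
      exact ZMod.injective_stdAddChar.ne h
    have hroot : (ZMod.stdAddChar (x k) : ℂ) ^ m k = 1 := by
      rw [← AddChar.map_nsmul_eq_pow]; simp
    rw [geom_sum_eq hne, hroot, sub_self, zero_div]

theorem enorm_sum_rademacher_pow_le (k s : ℕ) (x : VilenkinGroup m) :
    ‖∑ l ∈ Finset.range s, rademacher m k x ^ l‖ₑ ≤ s :=
  (enorm_sum_le _ _).trans (by simp [enorm_pow, enorm_rademacher])

theorem enorm_sum_sum_rademacher_pow_le (k s : ℕ) (x : VilenkinGroup m) :
    ‖∑ l ∈ Finset.range s, ∑ i ∈ Finset.range l, rademacher m k x ^ i‖ₑ ≤ s * s := by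
  refine (enorm_sum_le _ _).trans ?_
  refine (Finset.sum_le_card_nsmul _ _ (s : ℝ≥0∞) fun l hl => ?_).trans (by simp)
  refine (enorm_sum_rademacher_pow_le k l x).trans ?_
  exact_mod_cast (Finset.mem_range.1 hl).le

end PointwiseBounds

section Recursion

theorem dirichletKernel_mul_M_add (hm : ∀ k, 2 ≤ m k) {k s r : ℕ} (hs : s < m k) (hr : r ≤ M m k)
    (x : VilenkinGroup m) :
    dirichletKernel m (s * M m k + r) x =
      dirichletKernel m (s * M m k) x + rademacher m k x ^ s * dirichletKernel m r x := by
  rw [dirichletKernel, Finset.sum_range_add, dirichletKernel, dirichletKernel, Finset.mul_sum]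
  congr 1
  exact Finset.sum_congr rfl fun j hj => psi_mul_M_add hm hs ((Finset.mem_range.1 hj).trans_le hr) x

theorem dirichletKernel_mul_M (hm : ∀ k, 2 ≤ m k) {k s : ℕ} (hs : s ≤ m k) (x : VilenkinGroup m) :
    dirichletKernel m (s * M m k) x =
      (∑ l ∈ Finset.range s, rademacher m k x ^ l) * dirichletKernel m (M m k) x := by
  induction s with
  | zero => simp [dirichletKernel]
  | succ s ih =>
    rw [Nat.succ_mul, dirichletKernel_mul_M_add hm hs le_rfl, ih (Nat.le_of_succ_le hs),
      Finset.sum_range_succ, add_mul]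

theorem dirichletKernel_M (hm : ∀ k, 2 ≤ m k) (k : ℕ) (x : VilenkinGroup m) :
    dirichletKernel m (M m k) x = ∏ j ∈ Finset.range k, coordKernel m j x := by
  induction k with
  | zero => simp [dirichletKernel, M, psi_zero]
  | succ k ih =>
    rw [M, dirichletKernel_mul_M hm le_rfl, ih, Finset.prod_range_succ, coordKernel, mul_comm]

theorem fejerSum_mul_M_add (hm : ∀ k, 2 ≤ m k) {k s r : ℕ} (hs : s < m k) (hr : r ≤ M m k)
    (x : VilenkinGroup m) :
    fejerSum m (s * M m k + r) x =
      fejerSum m (s * M m k) x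
        + r * ((∑ l ∈ Finset.range s, rademacher m k x ^ l) * dirichletKernel m (M m k) x)
        + rademacher m k x ^ s * fejerSum m r x := by
  rw [fejerSum, Finset.sum_range_add, ← fejerSum, add_assoc]
  congr 1
  rw [Finset.sum_congr rfl fun j hj => dirichletKernel_mul_M_add hm hs
    ((Finset.mem_range.1 hj).le.trans hr) x, Finset.sum_add_distrib, Finset.sum_const,
    Finset.card_range, nsmul_eq_mul, ← Finset.mul_sum, dirichletKernel_mul_M hm hs.le, fejerSum]

theorem fejerSum_mul_M (hm : ∀ k, 2 ≤ m k) {k s : ℕ} (hs : s ≤ m k) (x : VilenkinGroup m) :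
    fejerSum m (s * M m k) x =
      M m k * (∑ l ∈ Finset.range s, ∑ i ∈ Finset.range l, rademacher m k x ^ i)
          * dirichletKernel m (M m k) x
        + (∑ l ∈ Finset.range s, rademacher m k x ^ l) * fejerSum m (M m k) x := by
  induction s with
  | zero => simp [fejerSum]
  | succ s ih =>
    rw [Nat.succ_mul, fejerSum_mul_M_add hm hs le_rfl, ih (Nat.le_of_succ_le hs),
      Finset.sum_range_succ, Finset.sum_range_succ]
    ring

theorem fejerSum_M (hm : ∀ k, 2 ≤ m k) (K : ℕ) (x : VilenkinGroup m) :
    fejerSum m (M m K) x = ∑ k ∈ Finset.range K, M m k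
      * (∑ l ∈ Finset.range (m k), ∑ i ∈ Finset.range l, rademacher m k x ^ i)
      * ∏ j ∈ (Finset.range K).erase k, coordKernel m j x := by
  induction K with
  | zero => simp [fejerSum, M, dirichletKernel]
  | succ K ih =>
    rw [M, fejerSum_mul_M hm le_rfl, Finset.sum_range_succ, add_comm, ih, ← coordKernel,
      dirichletKernel_M hm, Finset.range_add_one, Finset.erase_insert (by simp), Finset.mul_sum]
    congr 1
    refine Finset.sum_congr rfl fun k hk => ?_
    have hKk : K ≠ k := (Finset.mem_range.1 hk).ne'
    rw [Finset.erase_insert_of_ne hKk, Finset.prod_insert (by simp)]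
    ring

theorem enorm_fejerSum_M_le (hm : ∀ k, 2 ≤ m k) (K : ℕ) (x : VilenkinGroup m) :
    ‖fejerSum m (M m K) x‖ₑ ≤ ∑ k ∈ Finset.range K,
      M m k * (m k * m k) * ∏ j ∈ (Finset.range K).erase k, ‖coordKernel m j x‖ₑ := by
  have := neZero_of_two_le hm
  rw [fejerSum_M hm]
  refine (enorm_sum_le _ _).trans (Finset.sum_le_sum fun k _ => ?_)
  rw [enorm_mul, enorm_mul, enorm_natCast, enorm_finset_prod]
  gcongr
  exact enorm_sum_sum_rademacher_pow_le k (m k) x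

theorem enorm_fejerSum_mul_M_add_le (hm : ∀ k, 2 ≤ m k) {k s r : ℕ} (hs : s < m k)
    (hr : r ≤ M m k) (x : VilenkinGroup m) :
    ‖fejerSum m (s * M m k + r) x‖ₑ ≤
      (M m k * (s * s) + r * s) * ‖dirichletKernel m (M m k) x‖ₑ
        + s * ‖fejerSum m (M m k) x‖ₑ + ‖fejerSum m r x‖ₑ := by
  have := neZero_of_two_le hm
  set D := dirichletKernel m (M m k) x
  set σ := ∑ l ∈ Finset.range s, rademacher m k x ^ l
  set τ := ∑ l ∈ Finset.range s, ∑ i ∈ Finset.range l, rademacher m k x ^ i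
  rw [fejerSum_mul_M_add hm hs hr, fejerSum_mul_M hm hs.le]
  calc ‖M m k * τ * D + σ * fejerSum m (M m k) x + r * (σ * D)
        + rademacher m k x ^ s * fejerSum m r x‖ₑ
      ≤ M m k * ‖τ‖ₑ * ‖D‖ₑ + ‖σ‖ₑ * ‖fejerSum m (M m k) x‖ₑ + r * (‖σ‖ₑ * ‖D‖ₑ)
        + ‖fejerSum m r x‖ₑ := by
        refine (enorm_add_le _ _).trans (add_le_add ((enorm_add_le _ _).trans
          (add_le_add ((enorm_add_le _ _).trans ?_) ?_)) ?_) <;>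
        simp [enorm_mul, enorm_pow, enorm_rademacher, enorm_natCast]
    _ ≤ M m k * (s * s) * ‖D‖ₑ + s * ‖fejerSum m (M m k) x‖ₑ + r * (s * ‖D‖ₑ)
        + ‖fejerSum m r x‖ₑ := by
        gcongr
        exacts [enorm_sum_sum_rademacher_pow_le k s x, enorm_sum_rademacher_pow_le k s x,
          enorm_sum_rademacher_pow_le k s x]
    _ = (M m k * (s * s) + r * s) * ‖D‖ₑ + s * ‖fejerSum m (M m k) x‖ₑ + ‖fejerSum m r x‖ₑ := by
        ring

end Recursion

section Haar

theorem isAddLeftInvariant_haar (hm : ∀ k, 2 ≤ m k) : (haar m).IsAddLeftInvariant := by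
  have := isProbabilityMeasure_coordMeasure hm
  have (k : ℕ) : (coordMeasure m k).IsAddLeftInvariant := by
    unfold coordMeasure; infer_instance
  exact isAddLeftInvariant_infinitePi _

theorem isNegInvariant_haar (hm : ∀ k, 2 ≤ m k) : (haar m).IsNegInvariant := by
  have := isProbabilityMeasure_coordMeasure hm
  have (k : ℕ) : (coordMeasure m k).IsNegInvariant :=
    ⟨by rw [coordMeasure, Measure.neg, Measure.map_smul, Measure.map_neg_eq_self]⟩
  exact isNegInvariant_infinitePi _

end Haar

section KernelNorms

theorem lintegral_prod_enorm_coordKernel (hm : ∀ k, 2 ≤ m k) (s : Finset ℕ) :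
    ∫⁻ x, ∏ j ∈ s, ‖coordKernel m j x‖ₑ ∂haar m = 1 := by
  have := isProbabilityMeasure_coordMeasure hm
  have := neZero_of_two_le hm
  let g (j : ℕ) : ZMod (m j) → ℝ≥0∞ := ({0} : Set (ZMod (m j))).indicator fun _ => m j
  have hg (j : ℕ) : Measurable (g j) := measurable_from_top
  have hcoord (j : ℕ) (x : VilenkinGroup m) : ‖coordKernel m j x‖ₑ = g j (x j) := by
    by_cases h : x j = 0 <;> simp [coordKernel_eq_ite, g, h, enorm_natCast]
  have hindep := ProbabilityTheory.iIndepFun_infinitePi (P := coordMeasure m) (X := g) hg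
  simp only [hcoord, haar]
  rw [ProbabilityTheory.lintegral_prod_eq_prod_lintegral_of_indepFun s _ hindep
    fun j => (hg j).comp (measurable_pi_apply j)]
  refine Finset.prod_eq_one fun j _ => ?_
  rw [← lintegral_map (hg j) (measurable_pi_apply j), Measure.infinitePi_map_eval,
    lintegral_indicator_const (measurableSet_singleton _), coordMeasure_singleton]
  exact ENNReal.mul_inv_cancel (by exact_mod_cast NeZero.ne (m j)) (by simp)

theorem lintegral_enorm_dirichletKernel_M (hm : ∀ k, 2 ≤ m k) (k : ℕ) :
    ∫⁻ x, ‖dirichletKernel m (M m k) x‖ₑ ∂haar m = 1 := by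
  simp only [dirichletKernel_M hm, enorm_finset_prod, lintegral_prod_enorm_coordKernel hm]

theorem lintegral_enorm_fejerSum_M_le (hm : ∀ k, 2 ≤ m k) {B : ℕ} (hB : ∀ k, m k ≤ B) (K : ℕ) :
    ∫⁻ x, ‖fejerSum m (M m K) x‖ₑ ∂haar m ≤ B * B * M m K := by
  have hmeas (k : ℕ) : Measurable fun x : VilenkinGroup m =>
      ∏ j ∈ (Finset.range K).erase k, ‖coordKernel m j x‖ₑ :=
    Finset.measurable_fun_prod _ fun j _ => (measurable_coordKernel m j).enorm
  calc ∫⁻ x, ‖fejerSum m (M m K) x‖ₑ ∂haar m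
      ≤ ∫⁻ x, ∑ k ∈ Finset.range K, M m k * (m k * m k)
          * ∏ j ∈ (Finset.range K).erase k, ‖coordKernel m j x‖ₑ ∂haar m :=
        lintegral_mono fun x => enorm_fejerSum_M_le hm K x
    _ = ∑ k ∈ Finset.range K, (M m k * (m k * m k) : ℝ≥0∞) := by
        rw [lintegral_finsetSum _ fun k _ => (hmeas k).const_mul _]
        simp only [lintegral_const_mul _ (hmeas _), lintegral_prod_enorm_coordKernel hm, mul_one]
    _ ≤ ∑ k ∈ Finset.range K, (M m k * (B * B) : ℝ≥0∞) := by
        gcongr with k <;> exact hB k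
    _ ≤ B * B * M m K := by
        rw [← Finset.sum_mul, mul_comm]
        gcongr
        exact_mod_cast sum_M_le hm K

theorem lintegral_enorm_fejerSum_le (hm : ∀ k, 2 ≤ m k) {B : ℕ} (hB : ∀ k, m k ≤ B) (n : ℕ) :
    ∫⁻ x, ‖fejerSum m n x‖ₑ ∂haar m ≤ (B * B + B + 1 : ℕ) * n := by
  have := neZero_of_two_le hm
  suffices ∀ k n, n < M m k → ∫⁻ x, ‖fejerSum m n x‖ₑ ∂haar m ≤ (B * B + B + 1 : ℕ) * n from
    this n n (Nat.lt_two_pow_self.trans_le (two_pow_le_M hm n))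
  intro k
  induction k with
  | zero =>
    intro n hn
    obtain rfl : n = 0 := by simpa [M] using hn
    simp [fejerSum]
  | succ k ih =>
    intro n hn
    obtain ⟨s, r, hs, hr, rfl⟩ : ∃ s r, s < m k ∧ r < M m k ∧ s * M m k + r = n :=
      ⟨n / M m k, n % M m k, (Nat.div_lt_iff_lt_mul (M_pos k)).2 hn, Nat.mod_lt _ (M_pos k),
        Nat.div_add_mod' n (M m k)⟩
    have hmeas (n : ℕ) : Measurable fun x => ‖fejerSum m n x‖ₑ := (measurable_fejerSum m n).enorm
    have hmeasD : Measurable fun x => ‖dirichletKernel m (M m k) x‖ₑ :=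
      (measurable_dirichletKernel m _).enorm
    have hsB : s ≤ B := hs.le.trans (hB k)
    calc ∫⁻ x, ‖fejerSum m (s * M m k + r) x‖ₑ ∂haar m
        ≤ ∫⁻ x, (M m k * (s * s) + r * s) * ‖dirichletKernel m (M m k) x‖ₑ
            + s * ‖fejerSum m (M m k) x‖ₑ + ‖fejerSum m r x‖ₑ ∂haar m :=
          lintegral_mono fun x => enorm_fejerSum_mul_M_add_le hm hs hr.le x
      _ = (M m k * (s * s) + r * s) + s * ∫⁻ x, ‖fejerSum m (M m k) x‖ₑ ∂haar m
            + ∫⁻ x, ‖fejerSum m r x‖ₑ ∂haar m := by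
          rw [lintegral_add_right _ (hmeas r), lintegral_add_right _ ((hmeas _).const_mul _),
            lintegral_const_mul _ hmeasD, lintegral_const_mul _ (hmeas _),
            lintegral_enorm_dirichletKernel_M hm, mul_one]
      _ ≤ (M m k * (s * B) + M m k * s) + s * (B * B * M m k) + (B * B + B + 1 : ℕ) * r := by
          gcongr
          exacts [lintegral_enorm_fejerSum_M_le hm hB k, ih r hr]
      _ = (B * B + B + 1 : ℕ) * (s * M m k + r : ℕ) := by push_cast; ring

end KernelNorms

section PartialSums

theorem integrable_mul_conj_psi [∀ k, NeZero (m k)] {f : VilenkinGroup m → ℂ}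
    (hf : Integrable f (haar m)) (k : ℕ) :
    Integrable (fun t => f t * (starRingEnd ℂ) (psi m k t)) (haar m) :=
  hf.mul_bdd (c := 1)
    (Complex.continuous_conj.measurable.comp (measurable_psi m k)).aestronglyMeasurable
    (ae_of_all _ fun x => by simp [norm_psi])

theorem dirichletKernel_sub_mul [∀ k, NeZero (m k)] (n : ℕ) (x t : VilenkinGroup m) (c : ℂ) :
    dirichletKernel m n (x - t) * c =
      ∑ k ∈ Finset.range n, c * (starRingEnd ℂ) (psi m k t) * psi m k x := by
  rw [dirichletKernel, Finset.sum_mul]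
  exact Finset.sum_congr rfl fun k _ => by rw [psi_sub]; ring

theorem integrable_dirichletKernel_mul [∀ k, NeZero (m k)] {f : VilenkinGroup m → ℂ}
    (hf : Integrable f (haar m)) (n : ℕ) (x : VilenkinGroup m) :
    Integrable (fun t => dirichletKernel m n (x - t) * f t) (haar m) := by
  simp only [dirichletKernel_sub_mul]
  exact integrable_finsetSum _ fun k _ => (integrable_mul_conj_psi hf k).mul_const _

theorem partialSum_eq_integral [∀ k, NeZero (m k)] {f : VilenkinGroup m → ℂ}
    (hf : Integrable f (haar m)) (n : ℕ) (x : VilenkinGroup m) :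
    partialSum m f n x = ∫ t, dirichletKernel m n (x - t) * f t ∂haar m := by
  simp only [dirichletKernel_sub_mul]
  rw [integral_finsetSum _ fun k _ => (integrable_mul_conj_psi hf k).mul_const _]
  simp only [integral_mul_const, partialSum, fourierCoeff]

theorem sum_partialSum_eq_integral [∀ k, NeZero (m k)] {f : VilenkinGroup m → ℂ}
    (hf : Integrable f (haar m)) (n : ℕ) (x : VilenkinGroup m) :
    ∑ k ∈ Finset.range n, partialSum m f k x = ∫ t, fejerSum m n (x - t) * f t ∂haar m := by
  simp only [fejerSum, Finset.sum_mul, partialSum_eq_integral hf]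
  rw [integral_finsetSum _ fun k _ => integrable_dirichletKernel_mul hf k x]

theorem measurable_partialSum (m : ℕ → ℕ) (f : VilenkinGroup m → ℂ) (n : ℕ) :
    Measurable (partialSum m f n) :=
  Finset.measurable_fun_sum _ fun k _ => (measurable_psi m k).const_mul _

theorem eLpNorm_sum_partialSum_le (hm : ∀ k, 2 ≤ m k) {B : ℕ} (hB : ∀ k, m k ≤ B) {p : ℝ≥0∞}
    (hp1 : 1 ≤ p) (hp : p ≠ ∞) {f : VilenkinGroup m → ℂ} (hf : MemLp f p (haar m)) (n : ℕ) :
    eLpNorm (∑ k ∈ Finset.range n, partialSum m f k) p (haar m) ≤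
      n * ((B * B + B + 1 : ℕ) * eLpNorm f p (haar m)) := by
  have := neZero_of_two_le hm
  have := isProbabilityMeasure_haar hm
  have := isAddLeftInvariant_haar hm
  have := isNegInvariant_haar hm
  have hconv : ∑ k ∈ Finset.range n, partialSum m f k =
      fun x => ∫ t, fejerSum m n (x - t) • f t ∂haar m := by
    ext x
    simp only [Finset.sum_apply, sum_partialSum_eq_integral (hf.integrable hp1), smul_eq_mul]
  rw [hconv, ← mul_assoc, mul_comm (n : ℝ≥0∞)]
  refine eLpNorm_integral_kernel_smul_le (K := fun x t => fejerSum m n (x - t))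
    ((measurable_fejerSum m n).comp (measurable_fst.sub measurable_snd)) (fun x => ?_) (fun t => ?_)
    hp1 hp hf.1
  · rw [lintegral_sub_left_eq_self (fun y => ‖fejerSum m n y‖ₑ) x]
    exact lintegral_enorm_fejerSum_le hm hB n
  · rw [lintegral_sub_right_eq_self (fun y => ‖fejerSum m n y‖ₑ) t]
    exact lintegral_enorm_fejerSum_le hm hB n

end PartialSums

section FinitelyManyCoordinates

theorem fourierCoeff_eq_zero_of_dependsOn (hm : ∀ k, 2 ≤ m k) {N : ℕ} {g : VilenkinGroup m → ℂ}
    (hg : DependsOn g (Set.Iio N)) {k : ℕ} (hk : M m N ≤ k) : fourierCoeff m g k = 0 := by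
  have := neZero_of_two_le hm
  have := isAddLeftInvariant_haar hm
  obtain ⟨i, hNi, hi⟩ := exists_digit_ne_zero_of_M_le hm hk
  set a : VilenkinGroup m := Pi.single i 1
  have hga (x : VilenkinGroup m) : g (x + a) = g x := hg fun j hj => by
    have hji : j ≠ i := (lt_of_lt_of_le hj hNi).ne
    simp [a, Pi.single_eq_of_ne hji]
  have hrot : fourierCoeff m g k = fourierCoeff m g k * (starRingEnd ℂ) (psi m k a) := by
    calc fourierCoeff m g k
        = ∫ x, g (x + a) * (starRingEnd ℂ) (psi m k (x + a)) ∂haar m :=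
          (integral_add_right_eq_self (fun x => g x * (starRingEnd ℂ) (psi m k x)) a).symm
      _ = fourierCoeff m g k * (starRingEnd ℂ) (psi m k a) := by
          simp only [hga, psi_add, map_mul, ← mul_assoc, integral_mul_const, fourierCoeff]
  by_contra hne
  refine psi_single_ne_one hm hi ((map_eq_one_iff (starRingEnd ℂ) (RingHom.injective _)).1 ?_)
  exact (mul_eq_left₀ hne).1 hrot.symm

theorem partialSum_eq_partialSum_M_of_dependsOn (hm : ∀ k, 2 ≤ m k) {N : ℕ}
    {g : VilenkinGroup m → ℂ} (hg : DependsOn g (Set.Iio N)) {n : ℕ} (hn : M m N ≤ n) :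
    partialSum m g n = partialSum m g (M m N) := by
  ext x
  refine (Finset.sum_subset (Finset.range_mono hn) fun k _ hk => ?_).symm
  rw [fourierCoeff_eq_zero_of_dependsOn hm hg (by simpa using hk), zero_mul]

theorem partialSum_one (hm : ∀ k, 2 ≤ m k) {n : ℕ} (hn : 1 ≤ n) : partialSum m 1 n = 1 := by
  have := isProbabilityMeasure_haar hm
  have hone : DependsOn (1 : VilenkinGroup m → ℂ) (Set.Iio 0) := fun _ _ _ => rfl
  rw [partialSum_eq_partialSum_M_of_dependsOn hm hone hn]
  ext x
  simp [partialSum, M, fourierCoeff, psi_zero]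

theorem eq_of_dirichletKernel_M_sub_ne_zero (hm : ∀ k, 2 ≤ m k) {N : ℕ} {x t : VilenkinGroup m}
    (h : dirichletKernel m (M m N) (x - t) ≠ 0) {k : ℕ} (hk : k < N) : x k = t k := by
  have := neZero_of_two_le hm
  rw [dirichletKernel_M hm, Finset.prod_ne_zero_iff] at h
  have hcoord := h k (Finset.mem_range.2 hk)
  rw [coordKernel_eq_ite, ite_ne_right_iff] at hcoord
  exact sub_eq_zero.1 hcoord.1

theorem partialSum_eq_self_of_dependsOn (hm : ∀ k, 2 ≤ m k) {N : ℕ} {g : VilenkinGroup m → ℂ}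
    (hgi : Integrable g (haar m)) (hg : DependsOn g (Set.Iio N)) {n : ℕ} (hn : M m N ≤ n) :
    partialSum m g n = g := by
  have := neZero_of_two_le hm
  have := isProbabilityMeasure_haar hm
  rw [partialSum_eq_partialSum_M_of_dependsOn hm hg hn]
  have hone : Integrable (1 : VilenkinGroup m → ℂ) (haar m) := integrable_const 1
  ext x
  have hlocal (t : VilenkinGroup m) : dirichletKernel m (M m N) (x - t) * g t =
      dirichletKernel m (M m N) (x - t) * (1 : VilenkinGroup m → ℂ) t * g x := by
    by_cases h : dirichletKernel m (M m N) (x - t) = 0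
    · simp [h]
    · rw [Pi.one_apply, mul_one, hg fun k hk => eq_of_dirichletKernel_M_sub_ne_zero hm h hk]
  calc partialSum m g (M m N) x = partialSum m 1 (M m N) x * g x := by
        rw [partialSum_eq_integral hgi, partialSum_eq_integral hone]
        simp only [hlocal, integral_mul_const]
    _ = g x := by rw [partialSum_one hm (M_pos N), Pi.one_apply, one_mul]

end FinitelyManyCoordinates

section TMeans

theorem tMean_eq_smul_sum (m : ℕ → ℕ) (q : ℕ → ℝ) (f : VilenkinGroup m → ℂ) (n : ℕ) :
    tMean m q f n = (Q q n)⁻¹ • ∑ k ∈ Finset.range n, q k • partialSum m f k := by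
  ext x
  simp [tMean]

theorem measurable_tMean (m : ℕ → ℕ) (q : ℕ → ℝ) (f : VilenkinGroup m → ℂ) (n : ℕ) :
    Measurable (tMean m q f n) :=
  (Finset.measurable_fun_sum _ fun k _ => (measurable_partialSum m f k).const_mul _).const_mul _

theorem partialSum_sub [∀ k, NeZero (m k)] {f g : VilenkinGroup m → ℂ}
    (hf : Integrable f (haar m)) (hg : Integrable g (haar m)) (n : ℕ) :
    partialSum m (f - g) n = partialSum m f n - partialSum m g n := by
  ext x
  simp only [Pi.sub_apply, partialSum, fourierCoeff, sub_mul, ← Finset.sum_sub_distrib,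
    integral_sub (integrable_mul_conj_psi hf _) (integrable_mul_conj_psi hg _)]

theorem tMean_sub [∀ k, NeZero (m k)] (q : ℕ → ℝ) {f g : VilenkinGroup m → ℂ}
    (hf : Integrable f (haar m)) (hg : Integrable g (haar m)) (n : ℕ) :
    tMean m q (f - g) n = tMean m q f n - tMean m q g n := by
  simp only [tMean_eq_smul_sum, partialSum_sub hf hg, smul_sub, Finset.sum_sub_distrib]

theorem memLp_partialSum (hm : ∀ k, 2 ≤ m k) (f : VilenkinGroup m → ℂ) (n : ℕ) (p : ℝ≥0∞) :
    MemLp (partialSum m f n) p (haar m) := by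
  have := neZero_of_two_le hm
  have := isProbabilityMeasure_haar hm
  exact memLp_finsetSum _ fun k _ => MemLp.const_mul (.of_bound
    (measurable_psi m k).aestronglyMeasurable 1 (ae_of_all _ fun x => (norm_psi k x).le)) _

theorem exists_eLpNorm_tMean_le (hm : ∀ k, 2 ≤ m k) (hbdd : BddAbove (Set.range m)) {q : ℕ → ℝ}
    (hq : weightVariation q =O[atTop] Q q) {p : ℝ≥0∞} (hp1 : 1 ≤ p) (hp : p ≠ ∞) :
    ∃ C : ℝ≥0∞, C ≠ ∞ ∧ ∀ᶠ n in atTop, ∀ f, MemLp f p (haar m) →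
      eLpNorm (tMean m q f n) p (haar m) ≤ C * eLpNorm f p (haar m) := by
  obtain ⟨B, hB⟩ := hbdd
  obtain ⟨L, hL, hqL⟩ := hq.exists_nonneg
  refine ⟨ENNReal.ofReal L * (B * B + B + 1 : ℕ), by finiteness, ?_⟩
  filter_upwards [hqL.bound] with n hn f hf
  have hratio : ‖(Q q n)⁻¹‖ₑ * ENNReal.ofReal (weightVariation q n) ≤ ENNReal.ofReal L := by
    rw [← ofReal_norm, ← ENNReal.ofReal_mul (norm_nonneg _), norm_inv, mul_comm, ← div_eq_mul_inv]
    gcongr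
    exact div_le_of_le_mul₀ (norm_nonneg _) hL ((Real.le_norm_self _).trans hn)
  calc eLpNorm (tMean m q f n) p (haar m)
      = ‖(Q q n)⁻¹‖ₑ * eLpNorm (∑ k ∈ Finset.range n, q k • partialSum m f k) p (haar m) := by
        rw [tMean_eq_smul_sum, eLpNorm_const_smul]
    _ ≤ ‖(Q q n)⁻¹‖ₑ * (ENNReal.ofReal (weightVariation q n)
          * ((B * B + B + 1 : ℕ) * eLpNorm f p (haar m))) := by
        gcongr
        exact eLpNorm_sum_smul_le_weightVariation hp1
          (fun k => (measurable_partialSum m f k).aestronglyMeasurable)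
          (eLpNorm_sum_partialSum_le hm (fun k => hB ⟨k, rfl⟩) hp1 hp hf) q n
    _ ≤ ENNReal.ofReal L * (B * B + B + 1 : ℕ) * eLpNorm f p (haar m) := by
        rw [← mul_assoc, mul_assoc (ENNReal.ofReal L)]
        gcongr

theorem tMean_sub_self_of_partialSum_eq_self {q : ℕ → ℝ} {g : VilenkinGroup m → ℂ} {K : ℕ}
    (hg : ∀ k, K ≤ k → partialSum m g k = g) {n : ℕ} (hn : K ≤ n) (hQ : Q q n ≠ 0) :
    tMean m q g n - g = (Q q n)⁻¹ • ∑ k ∈ Finset.range K, q k • (partialSum m g k - g) := by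
  have htail : ∑ k ∈ Finset.range K, q k • (partialSum m g k - g) =
      ∑ k ∈ Finset.range n, q k • (partialSum m g k - g) :=
    Finset.sum_subset (Finset.range_mono hn) fun k _ hk => by
      rw [hg k (by simpa using hk), sub_self, smul_zero]
  rw [htail, tMean_eq_smul_sum]
  simp only [smul_sub, Finset.sum_sub_distrib, ← Finset.sum_smul]
  rw [← Q, inv_smul_smul₀ hQ]

theorem tendsto_eLpNorm_tMean_sub_of_dependsOn (hm : ∀ k, 2 ≤ m k) {q : ℕ → ℝ}
    (hQ : Tendsto (Q q) atTop atTop) {p : ℝ≥0∞} (hp1 : 1 ≤ p) {g : VilenkinGroup m → ℂ}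
    (hg : MemLp g p (haar m)) {N : ℕ} (hgN : DependsOn g (Set.Iio N)) :
    Tendsto (fun n => eLpNorm (tMean m q g n - g) p (haar m)) atTop (𝓝 0) := by
  have := isProbabilityMeasure_haar hm
  set R := ∑ k ∈ Finset.range (M m N), q k • (partialSum m g k - g)
  have hR : MemLp R p (haar m) :=
    memLp_finsetSum' _ fun k _ => ((memLp_partialSum hm g k p).sub hg).const_smul (q k)
  have hlim : Tendsto (fun n => ‖(Q q n)⁻¹‖ₑ * eLpNorm R p (haar m)) atTop (𝓝 0) := by
    have hinv : Tendsto (fun n => ‖(Q q n)⁻¹‖ₑ) atTop (𝓝 0) := by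
      simpa using hQ.inv_tendsto_atTop.enorm
    simpa using ENNReal.Tendsto.mul_const hinv (Or.inr hR.eLpNorm_ne_top)
  refine hlim.congr' ?_
  filter_upwards [eventually_ge_atTop (M m N), hQ.eventually_ne_atTop 0] with n hn hQn
  rw [tMean_sub_self_of_partialSum_eq_self (fun k hk =>
    partialSum_eq_self_of_dependsOn hm (hg.integrable hp1) hgN hk) hn hQn, eLpNorm_const_smul]

end TMeans

end Vilenkin

theorem corollary4_general (m : ℕ → ℕ) (hm : ∀ k, 2 ≤ m k) (hbdd : BddAbove (Set.range m))
    (q : ℕ → ℝ) (hQ : Tendsto (Vilenkin.Q q) atTop atTop)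
    (hq : weightVariation q =O[atTop] Vilenkin.Q q) (p : ℝ≥0∞) (hp1 : 1 ≤ p) (hp : p ≠ ∞)
    (f : VilenkinGroup m → ℂ) (hf : MemLp f p (Vilenkin.haar m)) :
    Tendsto (fun n => eLpNorm (Vilenkin.tMean m q f n - f) p (Vilenkin.haar m)) atTop (𝓝 0) := by
  have := Vilenkin.neZero_of_two_le hm
  have := Vilenkin.isProbabilityMeasure_haar hm
  obtain ⟨C, hC, hbound⟩ := Vilenkin.exists_eLpNorm_tMean_le hm hbdd hq hp1 hp
  refine tendsto_eLpNorm_sub_of_dense (T := fun n f => Vilenkin.tMean m q f n) hC hp1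
    (fun n f g hf hg => Vilenkin.tMean_sub q (hf.integrable hp1) (hg.integrable hp1) n)
    (fun n f _ => (Vilenkin.measurable_tMean m q f n).aestronglyMeasurable) hbound hf
    fun ε hε => ?_
  obtain ⟨g, hfg, hg, s, hgs⟩ := exists_dependsOn_finset_eLpNorm_sub_le hp hf hε
  obtain ⟨N, hN⟩ := s.exists_nat_subset_range
  have hgN : DependsOn g (Set.Iio N) := hgs.mono fun i hi => Finset.mem_range.1 (hN hi)
  exact ⟨g, hfg, hg, Vilenkin.tendsto_eLpNorm_tMean_sub_of_dependsOn hm hQ hp1 hg hgN⟩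

theorem corollary4 (m : ℕ → ℕ) (hm : ∀ k, 2 ≤ m k) (hbdd : BddAbove (Set.range m))
    (q : ℕ → ℝ) (hq : ∀ k, 0 ≤ q k) (hq0 : 0 < q 0)
    (hQ : Tendsto (fun n => Vilenkin.Q q n) atTop atTop)
    (hmono : Antitone q ∨
      (Monotone q ∧
        (fun n : ℕ => q (n - 1) / Vilenkin.Q q n) =O[atTop] (fun n : ℕ => 1 / (n : ℝ))))
    (p : ℝ≥0∞) (hp1 : 1 ≤ p) (hp : p ≠ ∞)
    (f : VilenkinGroup m → ℂ) (hf : MemLp f p (Vilenkin.haar m)) :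
    Tendsto (fun n : ℕ =>
        eLpNorm (fun x => Vilenkin.tMean m q f n x - f x) p (Vilenkin.haar m))
      atTop (𝓝 0) :=
  corollary4_general m hm hbdd q hQ (Vilenkin.weightVariation_isBigO_Q hq hQ hmono) p hp1 hp f hf
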